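/- Let $A:\mathbb N\times\mathbb N\to\mathbb N$ be the Ackermann function defined by $A(0,n)=2^n$, $A(k,0)=1$ and $A(k+1,n+1)=A(k,A(k+1,n))$ for all $k,n\in\mathbb N$. Let $\alpha:\mathbb N\to\mathbb N$ be its inverse: $\alpha(m)$ is the least $k\in\mathbb N$ such that $A(k,k)\ge m$. For $m\in\mathbb N$ let $|m|$ be the length of the binary representation of $m$ (so $|0|=1$ and $|m|=\lfloor\log_2 m\rfloor+1$ for $m\ge 1$). Then $\alpha$ is computable in linear time: there are a deterministic multitape Turing machine (with finitely many tapes, states and tape symbols) and a constant $C\in\mathbb N$ such that, for every $m\in\mathbb N$, the machine started with the binary representation of $m$ on its input tape and all other tapes blank halts after at most $C\,|m|$ steps with the binary representation of $\alpha(m)$ on its output tape. -/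

import Mathlib

namespace InverseAckermann

/-- The two-argument Ackermann function with `A(0,n) = 2^n`, `A(k,0) = 1` and
`A(k+1,n+1) = A(k, A(k+1,n))`. -/
def A : ℕ → ℕ → ℕ
  | 0, n => 2 ^ n
  | _ + 1, 0 => 1
  | k + 1, n + 1 => A k (A (k + 1) n)

/-- The diagonal `Ack(n) = A(n,n)`. -/
def Ack (n : ℕ) : ℕ := A n n

theorem lt_A (k n : ℕ) : n < A k n := by
  induction k generalizing n with
  | zero => rw [A]; exact Nat.lt_two_pow_self
  | succ k ih =>
    induction n with
    | zero => rw [A]; exact Nat.one_pos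
    | succ n ihn => rw [A]; exact lt_of_le_of_lt ihn (ih _)

theorem Ack_unbounded (n : ℕ) : ∃ k, n ≤ Ack k := ⟨n, (lt_A n n).le⟩

/-- The inverse of an unbounded function `f`: `Inv f h n` is the least `k` with `n ≤ f k`. -/
def Inv (f : ℕ → ℕ) (h : ∀ n, ∃ k, n ≤ f k) (n : ℕ) : ℕ := Nat.find (h n)

/-- The inverse Ackermann function. -/
def alpha : ℕ → ℕ := Inv Ack Ack_unbounded

/-- The binary representation of a natural number, most significant digit first, without
leading zeros; the number `0` is represented by the one-letter word `0`. -/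
def binRep (n : ℕ) : List Bool := if n = 0 then [false] else n.bits.reverse

/-- A deterministic multitape Turing machine with tapes indexed by `ι`, states `Q` and tape
alphabet `Γ`, whose blank symbol is `default`. The tapes are infinite in both directions.
Finiteness of `ι`, `Q` and `Γ` is required in `ComputableInTime`. -/
structure MultitapeTM (ι Q Γ : Type) [Inhabited Γ] where
  /-- The tape that holds the input at the start. -/
  inTape : ι
  /-- The tape that holds the output at the end. -/
  outTape : ι
  /-- The initial state. -/
  start : Q
  /-- The letters `0` and `1` of the tape alphabet. -/
  bit : Bool → Γ
  bit_injective : Function.Injective bit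
  bit_ne_blank : ∀ b, bit b ≠ default
  /-- The transition function: from the state and the scanned symbols it gives the new state and,
  for each tape, the symbol to write and the direction to move in (`none`: the head stays).
  The machine halts where it is undefined. -/
  trans : Q → (ι → Γ) → Option (Q × (ι → Γ × Option Turing.Dir))

namespace MultitapeTM

variable {ι Q Γ : Type} [Inhabited Γ]

/-- A configuration: the state, and for each tape its contents with the position of its head. -/
structure Cfg (ι Q Γ : Type) [Inhabited Γ] where
  state : Q
  tape : ι → Turing.Tape Γ

/-- Move the head of a tape by at most one cell. -/
def moveHead (d : Option Turing.Dir) (T : Turing.Tape Γ) : Turing.Tape Γ :=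
  match d with
  | none => T
  | some d => T.move d

/-- One step of the machine; `none` if the machine has halted. -/
def step (M : MultitapeTM ι Q Γ) (c : Cfg ι Q Γ) : Option (Cfg ι Q Γ) :=
  (M.trans c.state fun i => (c.tape i).head).map fun r =>
    { state := r.1
      tape := fun i => moveHead (r.2 i).2 ((c.tape i).write (r.2 i).1) }

/-- The tape that is blank except for the binary word `w`, its head on the first letter of `w`. -/
def wordTape (M : MultitapeTM ι Q Γ) (w : List Bool) : Turing.Tape Γ :=
  Turing.Tape.mk₁ (w.map M.bit)

/-- The initial configuration on the input word `w`: all tapes but the input tape are blank. -/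
def init [DecidableEq ι] (M : MultitapeTM ι Q Γ) (w : List Bool) : Cfg ι Q Γ where
  state := M.start
  tape := fun i => if i = M.inTape then M.wordTape w else M.wordTape []

/-- The machine, started on the input word `w`, halts after exactly `t` steps and then its output
tape holds the word `v` and nothing else. -/
def OutputsAfter [DecidableEq ι] (M : MultitapeTM ι Q Γ) (w v : List Bool) (t : ℕ) : Prop :=
  ∃ c : Cfg ι Q Γ, (fun o : Option (Cfg ι Q Γ) => o.bind M.step)^[t] (some (M.init w)) = some c ∧
    M.step c = none ∧ c.tape M.outTape = M.wordTape v

end MultitapeTM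

/-- `f : ℕ → ℕ` is computable by a multitape Turing machine, with integers in binary, in at most
`T(|m|)` steps on input `m`, where `|m|` is the length of the binary representation of `m`. -/
def ComputableInTime (f : ℕ → ℕ) (T : ℕ → ℕ) : Prop :=
  ∃ (ι Q Γ : Type) (_ : Fintype ι) (_ : DecidableEq ι) (_ : Fintype Q) (_ : Fintype Γ)
    (_ : Inhabited Γ) (M : MultitapeTM ι Q Γ),
    ∀ m : ℕ, ∃ t ≤ T (binRep m).length, M.OutputsAfter (binRep m) (binRep (f m)) t

/-- Computability in linear time. -/
def ComputableInLinearTime (f : ℕ → ℕ) : Prop :=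
  ∃ C : ℕ, ComputableInTime f fun n => C * n

end InverseAckermann

namespace InverseAckermann

/-! ### Arithmetic of the rows of the Ackermann function -/

/-- The rows of the Ackermann function, preceded by the row `1, 2, 4, 6, 8, …`. -/
def rowVal : ℕ → ℕ → ℕ
  | 0, n => if n = 0 then 1 else 2 * n
  | k + 1, n => A k n

theorem A_zero_right (k : ℕ) : A k 0 = 1 := by
  cases k <;> simp [A]

theorem rowVal_zero_right (k : ℕ) : rowVal k 0 = 1 := by
  cases k <;> simp [rowVal, A_zero_right]

theorem rowVal_succ_succ (k n : ℕ) :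
    rowVal (k + 1) (n + 1) = rowVal k (rowVal (k + 1) n) := by
  cases k with
  | zero => simp [rowVal, A, pow_succ, mul_comm]
  | succ k => simp [rowVal, A]

theorem A_strictMono (k : ℕ) : StrictMono (A k) := by
  cases k with
  | zero =>
    intro a b h
    simp only [A]
    exact Nat.pow_lt_pow_right one_lt_two h
  | succ k =>
    refine strictMono_nat_of_lt_succ fun n => ?_
    rw [A]
    exact lt_A _ _

theorem rowVal_strictMono (k : ℕ) : StrictMono (rowVal k) := by
  cases k with
  | zero =>
    refine strictMono_nat_of_lt_succ fun n => ?_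
    rcases Nat.eq_zero_or_pos n with rfl | hn
    · simp [rowVal]
    · simp only [rowVal, if_neg hn.ne', if_neg (Nat.succ_ne_zero n)]
      omega
  | succ k => exact A_strictMono k

theorem two_mul_le_A (k n : ℕ) : 2 * n ≤ A k n := by
  induction k generalizing n with
  | zero =>
    rw [A]
    cases n with
    | zero => simp
    | succ n =>
      have := Nat.lt_two_pow_self (n := n)
      rw [pow_succ]
      omega
  | succ k ih =>
    cases n with
    | zero => simp
    | succ n =>
      rw [A]
      have := lt_A (k + 1) n
      have := ih (A (k + 1) n)
      omega

open Classical in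
/-- The characteristic function of the range of the row `k`. -/
noncomputable def mark (k p : ℕ) : Bool := decide (∃ j, rowVal k j = p)

theorem mark_eq_true {k p : ℕ} : mark k p = true ↔ ∃ j, rowVal k j = p := by
  simp [mark]

/-- The number of elements of the row `k` below `p`. -/
noncomputable def cnt (k p : ℕ) : ℕ := Nat.count (fun x => mark k x = true) p

theorem cnt_zero (k : ℕ) : cnt k 0 = 0 := Nat.count_zero _

theorem cnt_succ (k p : ℕ) : cnt k (p + 1) = cnt k p + if mark k p = true then 1 else 0 :=
  Nat.count_succ _ _

theorem cnt_mono (k : ℕ) : Monotone (cnt k) := Nat.count_monotone _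

theorem mark_rowVal (k j : ℕ) : mark k (rowVal k j) = true := mark_eq_true.2 ⟨j, rfl⟩

theorem mark_zero (k : ℕ) : mark k 0 = false := by
  rw [← Bool.not_eq_true, mark_eq_true]
  rintro ⟨j, hj⟩
  have := (rowVal_strictMono k).monotone (Nat.zero_le j)
  rw [rowVal_zero_right] at this
  omega

theorem cnt_rowVal (k j : ℕ) : cnt k (rowVal k j) = j := by
  have h : (Finset.range (rowVal k j)).filter (fun x => mark k x = true)
      = (Finset.range j).image (rowVal k) := by
    ext x
    simp only [Finset.mem_filter, Finset.mem_range, Finset.mem_image, mark_eq_true]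
    constructor
    · rintro ⟨hx, i, rfl⟩
      exact ⟨i, (rowVal_strictMono k).lt_iff_lt.1 hx, rfl⟩
    · rintro ⟨i, hi, rfl⟩
      exact ⟨(rowVal_strictMono k) hi, i, rfl⟩
  rw [cnt, Nat.count_eq_card_filter_range, h,
    Finset.card_image_of_injective _ (rowVal_strictMono k).injective, Finset.card_range]

theorem cnt_le_iff (k p j : ℕ) : cnt k p ≤ j ↔ p ≤ rowVal k j := by
  constructor
  · intro h
    by_contra! hlt
    have h1 := cnt_mono k (Nat.succ_le_of_lt hlt)
    rw [Nat.succ_eq_add_one, cnt_succ, cnt_rowVal, if_pos (mark_rowVal k j)] at h1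
    omega
  · intro h
    have := cnt_mono k h
    rwa [cnt_rowVal] at this

theorem mark_succ_iff (k p : ℕ) (hp : 1 ≤ p) :
    mark (k + 1) p = true ↔
      mark k p = true ∧ (cnt k p = 0 ∨ mark (k + 1) (cnt k p) = true) := by
  constructor
  · rw [mark_eq_true]
    rintro ⟨j, rfl⟩
    cases j with
    | zero =>
      rw [rowVal_zero_right, ← rowVal_zero_right k]
      exact ⟨mark_rowVal _ _, Or.inl (cnt_rowVal _ _)⟩
    | succ j =>
      rw [rowVal_succ_succ]
      refine ⟨mark_rowVal _ _, Or.inr ?_⟩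
      rw [cnt_rowVal]
      exact mark_rowVal _ _
  · rintro ⟨h, h'⟩
    obtain ⟨i, rfl⟩ := mark_eq_true.1 h
    rw [cnt_rowVal] at h'
    rcases h' with rfl | h'
    · have := mark_rowVal (k + 1) 0
      rwa [rowVal_zero_right] at this ⊢
    · obtain ⟨j, rfl⟩ := mark_eq_true.1 h'
      rw [← rowVal_succ_succ]
      exact mark_rowVal _ _

/-- The invariant of the pass that turns the row `k` into the row `k + 1`: with `r = cnt k p`,
the number `r + d` is the least element at or above `r`, and the greatest element below `p`,
of the row `k + 1` with `0` adjoined. -/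
structure PassInv (k p d e : ℕ) : Prop where
  sum : cnt k p + d + e + 1 = p
  mem : cnt k p + d = 0 ∨ mark (k + 1) (cnt k p + d) = true
  below : ∀ x, cnt k p ≤ x → x < cnt k p + d → ¬ (x = 0 ∨ mark (k + 1) x = true)
  above : ∀ x, cnt k p + d < x → x < p → mark (k + 1) x ≠ true

theorem cnt_one (k : ℕ) : cnt k 1 = 0 := by
  rw [cnt_succ, cnt_zero, mark_zero]; simp

theorem passInv_one (k : ℕ) : PassInv k 1 0 0 where
  sum := by rw [cnt_one]
  mem := Or.inl (by rw [cnt_one])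
  below := fun x _ _ => by omega
  above := fun x _ _ => by omega

namespace PassInv

variable {k p d e : ℕ}

theorem mark_succ_of_not_mark (h : PassInv k p d e) (hb : mark k p = false) :
    mark (k + 1) p = false := by
  rw [← Bool.not_eq_true, mark_succ_iff k p (by have := h.sum; omega), hb]
  simp

theorem of_not_mark (h : PassInv k p d e) (hb : mark k p = false) :
    PassInv k (p + 1) d (e + 1) := by
  have hc : cnt k (p + 1) = cnt k p := by rw [cnt_succ, hb]; simp
  have hm := h.mark_succ_of_not_mark hb
  refine ⟨?_, ?_, ?_, ?_⟩ <;> rw [hc]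
  · have := h.sum; omega
  · exact h.mem
  · exact h.below
  · intro x h1 h2
    rcases Nat.lt_succ_iff_lt_or_eq.1 h2 with h2 | rfl
    · exact h.above x h1 h2
    · simp [hm]

theorem mark_succ_of_pos (h : PassInv k p (d + 1) e) : mark (k + 1) p = false := by
  rw [← Bool.not_eq_true, mark_succ_iff k p (by have := h.sum; omega)]
  exact fun h' => h.below _ le_rfl (by omega) h'.2

theorem of_mark_of_pos (h : PassInv k p (d + 1) e) (hb : mark k p = true) :
    PassInv k (p + 1) d (e + 1) := by
  have hc : cnt k (p + 1) = cnt k p + 1 := by rw [cnt_succ, hb]; simp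
  have hm := h.mark_succ_of_pos
  have hs : cnt k p + 1 + d = cnt k p + (d + 1) := by omega
  refine ⟨?_, ?_, ?_, ?_⟩ <;> rw [hc]
  · have := h.sum; omega
  · rw [hs]; exact h.mem
  · intro x h1 h2
    exact h.below x (by omega) (by omega)
  · intro x h1 h2
    rcases Nat.lt_succ_iff_lt_or_eq.1 h2 with h2 | rfl
    · exact h.above x (by omega) h2
    · simp [hm]

theorem mark_succ_of_zero (h : PassInv k p 0 e) (hb : mark k p = true) :
    mark (k + 1) p = true :=
  (mark_succ_iff k p (by have := h.sum; omega)).2 ⟨hb, h.mem⟩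

theorem of_mark_of_zero (h : PassInv k p 0 e) (hb : mark k p = true) :
    PassInv k (p + 1) e 0 := by
  have hc : cnt k (p + 1) = cnt k p + 1 := by rw [cnt_succ, hb]; simp
  have hs : cnt k p + 1 + e = p := by have := h.sum; omega
  refine ⟨?_, ?_, ?_, ?_⟩ <;> rw [hc]
  · omega
  · rw [hs]; exact Or.inr (h.mark_succ_of_zero hb)
  · rintro x h1 h2 (rfl | hx)
    · omega
    · exact h.above x (by omega) (by omega) hx
  · intro x h1 h2
    omega

end PassInv

theorem cnt_lt (k p : ℕ) (hp : 1 ≤ p) : cnt k p + 1 ≤ p := by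
  obtain ⟨p, rfl⟩ : ∃ q, p = q + 1 := ⟨p - 1, by omega⟩
  induction p with
  | zero => rw [cnt_one]
  | succ p ih =>
    rw [cnt_succ]
    have := ih (by omega)
    split_ifs <;> omega

/-- For `m > 1`, the number of elements of `{A(k,j) : j}` below `m`, by recursion on `k`. -/
noncomputable def level (m : ℕ) : ℕ → ℕ
  | 0 => Nat.clog 2 m
  | k + 1 => cnt (k + 2) (level m k) + 1

theorem level_le_iff {m : ℕ} (hm : 1 < m) (k j : ℕ) : level m k ≤ j ↔ m ≤ A k j := by
  induction k generalizing j with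
  | zero => rw [level, A, Nat.clog_le_iff_le_pow (by norm_num)]
  | succ k ih =>
    rw [level]
    cases j with
    | zero => rw [A]; omega
    | succ j => rw [A, ← ih, Nat.add_le_add_iff_right, cnt_le_iff]; rfl

theorem two_mul_cnt_le (k c : ℕ) : 2 * cnt (k + 1) c ≤ c + 1 := by
  have h : cnt (k + 1) c ≤ (c + 1) / 2 := by
    rw [cnt_le_iff]
    have := two_mul_le_A k ((c + 1) / 2)
    simp only [rowVal]
    omega
  omega

theorem alpha_eq_of {m k : ℕ} (hk : m ≤ Ack k) (hlt : ∀ i < k, ¬ m ≤ Ack i) :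
    alpha m = k := by
  rw [alpha, Inv, Nat.find_eq_iff]
  exact ⟨hk, fun i hi => hlt i hi⟩

/-! ### Binary representations -/

/-- Increment of a binary number given with its least significant digit first. -/
def incr : List Bool → List Bool
  | [] => [true]
  | false :: l => true :: l
  | true :: l => false :: incr l

theorem bits_succ (n : ℕ) : (n + 1).bits = incr n.bits := by
  induction n using Nat.strong_induction_on with
  | _ n ih =>
    rcases Nat.even_or_odd' n with ⟨k, rfl | rfl⟩
    · rw [Nat.bit1_bits]
      rcases Nat.eq_zero_or_pos k with rfl | hk
      · simp [incr]
      · rw [Nat.bit0_bits k (by omega)]; rfl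
    · have : 2 * k + 1 + 1 = 2 * (k + 1) := by ring
      rw [this, Nat.bit0_bits (k + 1) (by omega), Nat.bit1_bits, ih k (by omega)]; rfl

theorem binRep_reverse_succ (n : ℕ) : (binRep (n + 1)).reverse = incr (binRep n).reverse := by
  rw [binRep, if_neg (by omega), List.reverse_reverse, bits_succ]
  rcases Nat.eq_zero_or_pos n with rfl | hn
  · simp [binRep, incr]
  · rw [binRep, if_neg (by omega), List.reverse_reverse]

theorem length_incr_le (l : List Bool) : (incr l).length ≤ l.length + 1 := by
  induction l with
  | nil => simp [incr]
  | cons b l ih => cases b <;> simp [incr, ih]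

theorem length_binRep_le (n : ℕ) : (binRep n).length ≤ n + 1 := by
  induction n with
  | zero => simp [binRep]
  | succ n ih =>
    have h := length_incr_le (binRep n).reverse
    rw [← binRep_reverse_succ] at h
    simp only [List.length_reverse] at h
    omega

theorem binRep_shape (m : ℕ) (hm : 1 ≤ m) : ∃ l : List Bool, binRep m = true :: l ∧
    2 ^ l.length ≤ m ∧ m < 2 ^ (l.length + 1) ∧ (true ∈ l ↔ m ≠ 2 ^ l.length) := by
  induction m using Nat.strong_induction_on with
  | _ m ih =>
    rcases Nat.lt_or_ge m 2 with h | h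
    · obtain rfl : m = 1 := by omega
      exact ⟨[], by simp [binRep], by simp⟩
    · rcases Nat.even_or_odd' m with ⟨k, rfl | rfl⟩
      · obtain ⟨l, h1, h2, h3, h4⟩ := ih k (by omega) (by omega)
        rw [binRep, if_neg (by omega)] at h1
        refine ⟨l ++ [false], ?_, ?_, ?_, ?_⟩
        · rw [binRep, if_neg (by omega), Nat.bit0_bits k (by omega), List.reverse_cons, h1]
          rfl
        · simp [pow_succ] at *; omega
        · simp [pow_succ] at *; omega
        · simp [pow_succ, h4]; omega
      · obtain ⟨l, h1, h2, h3, h4⟩ := ih k (by omega) (by omega)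
        rw [binRep, if_neg (by omega)] at h1
        refine ⟨l ++ [true], ?_, ?_, ?_, ?_⟩
        · rw [binRep, if_neg (by omega), Nat.bit1_bits k, List.reverse_cons, h1]
          rfl
        · simp [pow_succ] at *; omega
        · simp [pow_succ] at *; omega
        · simp [pow_succ]; omega

theorem binRep_clog (m : ℕ) : ∃ (b : Bool) (l : List Bool), binRep m = b :: l ∧
    Nat.clog 2 m = l.length + if true ∈ l then 1 else 0 := by
  rcases Nat.eq_zero_or_pos m with rfl | hm
  · exact ⟨false, [], by simp [binRep], by simp⟩
  · obtain ⟨l, h1, h2, h3, h4⟩ := binRep_shape m hm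
    refine ⟨true, l, h1, ?_⟩
    by_cases h : m = 2 ^ l.length
    · rw [if_neg (by rw [h4]; exact not_not.2 h), h, Nat.clog_pow _ _ (by norm_num), add_zero]
    · rw [if_pos (h4.2 h)]
      refine le_antisymm ?_ ?_
      · rw [Nat.clog_le_iff_le_pow (by norm_num)]; exact h3.le
      · rw [Nat.succ_le_iff, Nat.lt_clog_iff_pow_lt (by norm_num)]
        exact lt_of_le_of_ne h2 (Ne.symm h)

open Turing

/-! ### Tapes over the alphabet `Option Bool` -/

/-- The tape with `l` to the left of the head (nearest cell first) and `r` from the head on. -/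
abbrev tp (l r : List (Option Bool)) : Tape (Option Bool) := Tape.mk₂ l r

theorem listBlank_nil : ListBlank.mk [(none : Option Bool)] = ListBlank.mk [] := by
  apply ListBlank.ext
  rintro (_ | i) <;> rfl

theorem tp_head (l r : List (Option Bool)) : (tp l r).head = r.headI := rfl

theorem tp_write (l r : List (Option Bool)) (a : Option Bool) :
    (tp l r).write a = tp l (a :: r.tail) := by
  simp only [tp, Tape.mk₂, ← ListBlank.cons_mk, ← ListBlank.tail_mk]
  rw [← ListBlank.cons_head_tail (ListBlank.mk r), Tape.write_mk', ListBlank.tail_cons]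

theorem tp_move_left (l r : List (Option Bool)) :
    (tp l r).move Dir.left = tp l.tail (l.headI :: r) := by
  simp [tp, Tape.mk₂, Tape.move_left_mk']

theorem tp_move_right (l r : List (Option Bool)) :
    (tp l r).move Dir.right = tp (r.headI :: l) r.tail := by
  simp [tp, Tape.mk₂, Tape.move_right_mk']

theorem tp_none_left (r : List (Option Bool)) : tp [none] r = tp [] r := by
  simp only [tp, Tape.mk₂, listBlank_nil]

theorem tp_none_right (l : List (Option Bool)) : tp l [none] = tp l [] := by
  simp only [tp, Tape.mk₂, listBlank_nil]

theorem tp_cons_none (l : List (Option Bool)) (a : Option Bool) : tp l [a, none] = tp l [a] := by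
  simp only [tp, Tape.mk₂]
  rw [← ListBlank.cons_mk, listBlank_nil, ListBlank.cons_mk]

/-- The tape with the word `l` (last letter first), its head on the last letter. -/
abbrev endTape (l : List Bool) : Tape (Option Bool) := tp (l.tail.map some) [l.head?]

/-- The head of the tape `T`, moved `n` cells to the right. -/
abbrev shift (n : ℕ) (T : Tape (Option Bool)) : Tape (Option Bool) := (Tape.move Dir.right)^[n] T

theorem shift_move_right (n : ℕ) (T : Tape (Option Bool)) :
    (shift n T).move Dir.right = shift (n + 1) T :=
  (Function.iterate_succ_apply' _ _ _).symm

theorem shift_move_left (n : ℕ) (T : Tape (Option Bool)) :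
    (shift (n + 1) T).move Dir.left = shift n T := by
  rw [← shift_move_right, Tape.move_right_left]

/-- A counter: a tape that is blank except for the cell `0`, its head on the cell `n`. -/
abbrev ctr (n : ℕ) : Tape (Option Bool) := shift n (tp [] [some true])

theorem shift_head (n : ℕ) (l : List (Option Bool)) : (shift n (tp [] l)).head = l.getI n := by
  rw [Tape.move_right_n_head, tp, Tape.mk₂, Tape.mk'_nth_nat, ListBlank.nth_mk]

theorem ctr_zero_head : (ctr 0).head = some true := rfl

theorem ctr_succ_head (n : ℕ) : (ctr (n + 1)).head = none := by
  rw [shift_head]; rfl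

/-! ### The machine -/

/-- The tapes: the input, the current row, the next row, three counters, the index of the row in
unary, the output. -/
inductive Tp
  | inp | cur | nxt | cnt₁ | cnt₂ | cut | idx | out
  deriving DecidableEq

instance : Fintype Tp where
  elems := {.inp, .cur, .nxt, .cnt₁, .cnt₂, .cut, .idx, .out}
  complete := fun t => by cases t <;> simp

/-- The states. -/
inductive St
  | init
  | read (e : Bool) (ph : Fin 4)
  | back (stage : Fin 3)
  | row (n : Bool)
  | pass (n role : Bool)
  | inc | ret | fin | halt
  deriving DecidableEq, Fintype

/-- A family indexed by the tapes. -/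
def fam {α : Type} (i x y d e w k o : α) : Tp → α
  | .inp => i
  | .cur => x
  | .nxt => y
  | .cnt₁ => d
  | .cnt₂ => e
  | .cut => w
  | .idx => k
  | .out => o

/-- The letter written at a position of the row `1, 2, 4, 6, …`, from the phase of the position. -/
def phaseMark (ph : Fin 4) : Bool := ph = 1 ∨ ph = 2

/-- The phase of the next position. -/
def phaseNext (ph : Fin 4) : Fin 4 := if ph = 3 then 2 else ph + 1

/-- The direction in which a counter with the scanned symbol `s` moves when it is decreased. -/
def decr (s : Option Bool) : Option Dir := if s = none then some Dir.left else none

/-- The transition function. -/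
def delta (q : St) (h : Tp → Option Bool) : Option (St × (Tp → Option Bool × Option Dir)) :=
  let s (t : Tp) (m : Option Dir) : Option Bool × Option Dir := (h t, m)
  let R := some Dir.right
  let L := some Dir.left
  match q with
  | .init => some (.read false 0, fam (s .inp R) (s .cur none) (s .nxt none) (some true, none)
      (some true, none) (some true, none) (s .idx none) (s .out none))
  | .read e ph =>
    match h .inp with
    | some b => some (.read (e || b) (phaseNext ph), fam (s .inp R) (s .cur none)
        (some (phaseMark ph), R) (s .cnt₁ none) (s .cnt₂ none) (s .cut none) (s .idx none)
        (s .out none))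
    | none => some (.back 0, fam (s .inp none) (s .cur none)
        (if e then (some (phaseMark ph), none) else s .nxt L) (s .cnt₁ none) (s .cnt₂ none)
        (s .cut none) (s .idx none) (s .out none))
  | .back stage =>
    match h .nxt with
    | some b => some (.back stage, fam (s .inp none)
        (if h .cut = none then s .cur none else (some b, L)) (none, L)
        (s .cnt₁ (decr (h .cnt₁))) (s .cnt₂ (decr (h .cnt₂))) (s .cut (decr (h .cut)))
        (s .idx L) (s .out none))
    | none => some (if stage = 0 then .row false else if stage = 1 then .row true else .inc,
        fam (s .inp none) (s .cur R) (s .nxt none) (s .cnt₁ none) (s .cnt₂ none) (s .cut none)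
        (if stage = 0 then s .idx none else (some true, none))
        (if stage = 1 then (some false, none) else s .out none))
  | .row n =>
    match h .cur with
    | none => some (.halt, fam (s .inp none) (s .cur none) (s .nxt none) (s .cnt₁ none)
        (s .cnt₂ none) (s .cut none) (s .idx none) (some false, none))
    | some _ => some (.pass n false, fam (s .inp none) (none, R) (some false, R) (s .cnt₁ none)
        (s .cnt₂ none) (s .cut none) (s .idx R) (s .out none))
  | .pass n role =>
    match h .cur with
    | none =>
      if h .idx = none then
        some (.back (if n then 2 else 1), fam (s .inp none) (s .cur none) (s .nxt L)
          (s .cnt₁ none) (s .cnt₂ none) (s .cut none) (s .idx L) (s .out none))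
      else
        some (.fin, fam (s .inp none) (s .cur none) (s .nxt none)
          (s .cnt₁ none) (s .cnt₂ none) (s .cut none) (s .idx none) (s .out none))
    | some false => some (.pass n role, fam (s .inp none) (none, R) (some false, R)
        (s .cnt₁ (if role then R else none)) (s .cnt₂ (if role then none else R))
        (s .cut (if n then R else none)) (s .idx R) (s .out none))
    | some true =>
      if h (if role then .cnt₂ else .cnt₁) = none then
        some (.pass n role, fam (s .inp none) (none, R) (some false, R)
          (s .cnt₁ (if role then R else L)) (s .cnt₂ (if role then L else R))
          (s .cut (if n then R else none)) (s .idx R) (s .out none))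
      else
        some (.pass n (!role), fam (s .inp none) (none, R) (some true, R)
          (s .cnt₁ none) (s .cnt₂ none) (s .cut none) (s .idx R) (s .out none))
  | .inc =>
    if h .out = some true then
      some (.inc, fam (s .inp none) (s .cur none) (s .nxt none) (s .cnt₁ none) (s .cnt₂ none)
        (s .cut none) (s .idx none) (some false, L))
    else
      some (.ret, fam (s .inp none) (s .cur none) (s .nxt none) (s .cnt₁ none) (s .cnt₂ none)
        (s .cut none) (s .idx none) (some true, none))
  | .ret => some (if h .out = none then .row true else .ret, fam (s .inp none) (s .cur none)
      (s .nxt none) (s .cnt₁ none) (s .cnt₂ none) (s .cut none) (s .idx none)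
      (s .out (if h .out = none then L else R)))
  | .fin => some (if h .out = none then .halt else .fin, fam (s .inp none) (s .cur none)
      (s .nxt none) (s .cnt₁ none) (s .cnt₂ none) (s .cut none) (s .idx none)
      (s .out (if h .out = none then R else L)))
  | .halt => none

/-- The machine that computes the inverse Ackermann function. -/
def machine : MultitapeTM Tp St (Option Bool) where
  inTape := .inp
  outTape := .out
  start := .init
  bit := some
  bit_injective := Option.some_injective _
  bit_ne_blank := fun _ => Option.some_ne_none _
  trans := delta

/-- The configurations of the machine. -/
abbrev conf (q : St) (i x y d e w k o : Tape (Option Bool)) :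
    MultitapeTM.Cfg Tp St (Option Bool) := ⟨q, fam i x y d e w k o⟩

/-- The machine gets from `c` to `c'` in `n` steps. -/
def Run (n : ℕ) (c c' : MultitapeTM.Cfg Tp St (Option Bool)) : Prop :=
  (fun o : Option (MultitapeTM.Cfg Tp St (Option Bool)) => o.bind machine.step)^[n] (some c)
    = some c'

theorem Run.refl (c : MultitapeTM.Cfg Tp St (Option Bool)) : Run 0 c c := rfl

theorem Run.trans {m n : ℕ} {a b c : MultitapeTM.Cfg Tp St (Option Bool)} (h : Run m a b)
    (h' : Run n b c) : Run (m + n) a c := by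
  unfold Run at *
  rw [Nat.add_comm, Function.iterate_add_apply, h, h']

theorem Run.single {a b : MultitapeTM.Cfg Tp St (Option Bool)} (h : machine.step a = some b) :
    Run 1 a b := h

theorem step_conf (q : St) (i x y d e w k o : Tape (Option Bool)) {q' : St}
    {ai ax ay ad ae aw ak ao : Option Bool × Option Dir}
    (h : delta q (fam i.head x.head y.head d.head e.head w.head k.head o.head)
      = some (q', fam ai ax ay ad ae aw ak ao)) :
    Run 1 (conf q i x y d e w k o)
      (conf q' (MultitapeTM.moveHead ai.2 (i.write ai.1)) (MultitapeTM.moveHead ax.2 (x.write ax.1))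
        (MultitapeTM.moveHead ay.2 (y.write ay.1)) (MultitapeTM.moveHead ad.2 (d.write ad.1))
        (MultitapeTM.moveHead ae.2 (e.write ae.1)) (MultitapeTM.moveHead aw.2 (w.write aw.1))
        (MultitapeTM.moveHead ak.2 (k.write ak.1)) (MultitapeTM.moveHead ao.2 (o.write ao.1))) := by
  apply Run.single
  have hf : (fun t => (fam i x y d e w k o t).head)
      = fam i.head x.head y.head d.head e.head w.head k.head o.head := by
    funext t; cases t <;> rfl
  simp only [MultitapeTM.step, machine, hf, h, Option.map_some]
  congr 2
  funext t
  cases t <;> rfl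

theorem headI_map_some (l : List Bool) : (l.map some).headI = l.head? := by
  cases l <;> rfl

theorem moveHead_none (T : Tape (Option Bool)) : MultitapeTM.moveHead none T = T := rfl

theorem moveHead_some (d : Dir) (T : Tape (Option Bool)) :
    MultitapeTM.moveHead (some d) T = T.move d := rfl

/-! ### The binary counter on the output tape -/

section Output

variable (i x y d e w k : Tape (Option Bool))

theorem run_inc (l zs : List Bool) : ∃ n ≤ l.length + 1, ∃ l' r' : List Bool,
    Run n (conf .inc i x y d e w k (tp (l.tail.map some) (l.head? :: zs.map some)))
      (conf .ret i x y d e w k (tp (l'.map some) (r'.map some))) ∧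
    r'.reverse ++ l' = zs.reverse ++ incr l ∧ r'.length ≤ l.length + zs.length + 1 := by
  induction l generalizing zs with
  | nil =>
    refine ⟨1, by simp, [], true :: zs, ?_, by simp [incr], by simp⟩
    have h := step_conf .inc i x y d e w k (tp [] (none :: zs.map some)) rfl
    simp only [fam, Tape.write_self, moveHead_none, tp_write] at h
    exact h
  | cons b l ih =>
    cases b with
    | false =>
      refine ⟨1, by simp, l, true :: zs, ?_, by simp [incr], by simp⟩
      have h := step_conf .inc i x y d e w k (tp (l.map some) (some false :: zs.map some)) rfl
      simp only [fam, Tape.write_self, moveHead_none, tp_write] at h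
      exact h
    | true =>
      obtain ⟨n, hn, l', r', h1, h2, h3⟩ := ih (false :: zs)
      refine ⟨1 + n, by simp; omega, l', r', ?_, by simpa [incr] using h2, by
        simp at h3 ⊢; omega⟩
      rw [List.map_tail] at h1
      refine Run.trans ?_ h1
      have h := step_conf .inc i x y d e w k (tp (l.map some) (some true :: zs.map some)) rfl
      simp only [fam, Tape.write_self, moveHead_none, moveHead_some, tp_write, tp_move_left,
        headI_map_some] at h
      exact h

theorem run_ret (l r : List Bool) :
    Run (r.length + 1) (conf .ret i x y d e w k (tp (l.map some) (r.map some)))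
      (conf (.row true) i x y d e w k (endTape (r.reverse ++ l))) := by
  induction r generalizing l with
  | nil =>
    have h := step_conf .ret i x y d e w k (tp (l.map some) []) (q' := .row true)
      (ao := (none, some Dir.left)) rfl
    rw [List.length_nil, Nat.zero_add, endTape, List.map_tail]
    simp only [fam, Tape.write_self, moveHead_none, moveHead_some, tp_write, tp_move_left,
        headI_map_some, List.tail_nil, tp_cons_none] at h
    exact h
  | cons b r ih =>
    have h := step_conf .ret i x y d e w k (tp (l.map some) (some b :: r.map some)) (q' := .ret)
      (ao := (some b, some Dir.right)) rfl
    have h2 := ih (b :: l)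
    rw [List.length_cons, Nat.add_comm]
    rw [List.reverse_cons, List.append_assoc]
    refine Run.trans ?_ h2
    simp only [fam, Tape.write_self, moveHead_none, moveHead_some, tp_write, tp_move_right] at h
    exact h

theorem run_incr (l : List Bool) : ∃ n ≤ 2 * l.length + 3,
    Run n (conf .inc i x y d e w k (endTape l))
      (conf (.row true) i x y d e w k (endTape (incr l))) := by
  obtain ⟨n, hn, l', r', h1, h2, h3⟩ := run_inc i x y d e w k l []
  simp only [List.reverse_nil, List.nil_append] at h2
  refine ⟨n + (r'.length + 1), by simp at h3; omega, ?_⟩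
  rw [← h2]
  exact h1.trans (run_ret i x y d e w k l' r')

theorem run_fin (l r : List Bool) :
    Run (l.length + 1)
      (conf .fin i x y d e w k (tp (l.tail.map some) (l.head? :: r.map some)))
      (conf .halt i x y d e w k (tp [] ((l.reverse ++ r).map some))) := by
  induction l generalizing r with
  | nil =>
    have h := step_conf .fin i x y d e w k (tp [] (none :: r.map some)) (q' := .halt)
      (ao := (none, some Dir.right)) rfl
    rw [List.length_nil, Nat.zero_add]
    simp only [fam, Tape.write_self, moveHead_none, moveHead_some, tp_write, tp_move_right,
      List.headI_cons, List.tail_cons, tp_none_left] at h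
    exact h
  | cons b l ih =>
    have h := step_conf .fin i x y d e w k (tp (l.map some) (some b :: r.map some)) (q' := .fin)
      (ao := (some b, some Dir.left)) rfl
    rw [List.length_cons, Nat.add_comm, List.reverse_cons, List.append_assoc]
    have h2 := ih (b :: r)
    rw [List.map_tail] at h2
    refine Run.trans ?_ h2
    simp only [fam, Tape.write_self, moveHead_none, moveHead_some, tp_write, tp_move_left, headI_map_some] at h
    exact h

end Output

/-! ### The way back -/

theorem moveHead_decr_ctr (n : ℕ) :
    MultitapeTM.moveHead (decr (ctr n).head) (ctr n) = ctr (n - 1) := by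
  cases n with
  | zero => rfl
  | succ n =>
    rw [ctr_succ_head, decr, if_pos rfl, moveHead_some, shift_move_left, Nat.add_sub_cancel]

theorem run_back (st : Fin 3) (i k o : Tape (Option Bool)) (ys xs : List Bool) (a b c : ℕ)
    (ha : a ≤ ys.length) (hb : b ≤ ys.length) (hc : c ≤ ys.length) :
    Run ys.length
      (conf (.back st) i (tp [] (none :: xs.map some)) (endTape ys) (ctr a) (ctr b) (ctr c)
        (shift ys.length k) o)
      (conf (.back st) i (tp [] (none :: ((ys.drop c).reverse ++ xs).map some)) (tp [] [])
        (ctr 0) (ctr 0) (ctr 0) k o) := by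
  induction ys generalizing xs a b c with
  | nil =>
    simp only [List.length_nil, Nat.le_zero] at ha hb hc
    subst ha hb hc
    simp only [List.length_nil, endTape, List.tail_nil, List.map_nil, List.head?_nil,
      tp_none_right, List.drop_nil, List.reverse_nil, List.nil_append]
    exact Run.refl _
  | cons s ys ih =>
    simp only [List.length_cons] at ha hb hc
    have h := step_conf (.back st) i (tp [] (none :: xs.map some)) (endTape (s :: ys)) (ctr a)
      (ctr b) (ctr c) (shift (ys.length + 1) k) o rfl
    simp only [Tape.write_self, moveHead_none, moveHead_some, moveHead_decr_ctr,
      shift_move_left, fam, tp_write, List.tail_cons, tp_move_left, headI_map_some,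
      tp_cons_none] at h
    rw [List.length_cons]
    simp only [endTape, List.map_tail] at ih ⊢
    cases c with
    | zero =>
      have h2 := ih (s :: xs) (a - 1) (b - 1) 0 (by omega) (by omega) (by omega)
      have h3 : (ys.drop 0).reverse ++ s :: xs = ((s :: ys).drop 0).reverse ++ xs := by simp
      rw [h3] at h2
      simp only [ctr_zero_head, reduceCtorEq, if_false, moveHead_some, tp_move_left,
        Nat.zero_sub] at h
      have h4 := Run.trans h h2
      rwa [Nat.add_comm 1 ys.length] at h4
    | succ c =>
      have h2 := ih xs (a - 1) (b - 1) c (by omega) (by omega) (by omega)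
      simp only [ctr_succ_head, if_true, moveHead_none, Nat.add_sub_cancel] at h
      have h4 := Run.trans h h2
      rwa [Nat.add_comm 1 ys.length] at h4

/-! ### Reading the input -/

/-- The phase of a position. -/
def phase (p : ℕ) : Fin 4 := phaseNext^[p] 0

theorem phase_succ (p : ℕ) : phase (p + 1) = phaseNext (phase p) :=
  Function.iterate_succ_apply' _ _ _

theorem phase_two_mul (j : ℕ) : phase (2 * j + 2) = 2 := by
  induction j with
  | zero => rfl
  | succ j ih =>
    have : 2 * (j + 1) + 2 = 2 * j + 2 + 1 + 1 := by ring
    rw [this, phase_succ, phase_succ, ih]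
    rfl

theorem phaseMark_phase (p : ℕ) : phaseMark (phase p) = mark 0 p := by
  obtain rfl | rfl | ⟨j, rfl | rfl⟩ : p = 0 ∨ p = 1 ∨ ∃ j, p = 2 * j + 2 ∨ p = 2 * j + 2 + 1 := by
    rcases Nat.even_or_odd' p with ⟨j, hj | hj⟩
    · by_cases h : p = 0
      · exact Or.inl h
      · exact Or.inr (Or.inr ⟨j - 1, by omega⟩)
    · by_cases h : p = 1
      · exact Or.inr (Or.inl h)
      · exact Or.inr (Or.inr ⟨j - 1, by omega⟩)
  · rw [mark_zero]; rfl
  · rw [← rowVal_zero_right 0, mark_rowVal, rowVal_zero_right]; rfl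
  · have h : rowVal 0 (j + 1) = 2 * j + 2 := by simp [rowVal]; ring
    rw [phase_two_mul, ← h, mark_rowVal]; rfl
  · have h : mark 0 (2 * j + 2 + 1) = false := by
      rw [← Bool.not_eq_true, mark_eq_true]
      rintro ⟨i, hi⟩
      simp only [rowVal] at hi
      split_ifs at hi <;> omega
    rw [phase_succ, phase_two_mul, h]; rfl

/-- The letters of the row `k` at the positions below `p`, the last position first. -/
noncomputable def revRow (k p : ℕ) : List Bool := (List.range p).reverse.map (mark k)

theorem revRow_succ (k p : ℕ) : revRow k (p + 1) = mark k p :: revRow k p := by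
  simp [revRow, List.range_succ]

theorem length_revRow (k p : ℕ) : (revRow k p).length = p := by simp [revRow]

theorem drop_revRow (k p w : ℕ) : (revRow k p).drop w = revRow k (p - w) := by
  induction w generalizing p with
  | zero => rfl
  | succ w ih =>
    cases p with
    | zero => simp [revRow]
    | succ p => rw [revRow_succ, List.drop_succ_cons, ih, Nat.add_sub_add_right]

theorem run_read (x d e w k o : Tape (Option Bool)) (l : List Bool) (il : List (Option Bool))
    (p : ℕ) (s : Bool) :
    Run l.length
      (conf (.read s (phase p)) (tp il (l.map some)) x (tp ((revRow 0 p).map some) []) d e w k o)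
      (conf (.read (s || decide (true ∈ l)) (phase (p + l.length)))
        (tp (l.reverse.map some ++ il) []) x
        (tp ((revRow 0 (p + l.length)).map some) []) d e w k o) := by
  induction l generalizing il p s with
  | nil => simpa using Run.refl _
  | cons b l ih =>
    have h := step_conf (.read s (phase p)) (tp il (some b :: l.map some)) x
      (tp ((revRow 0 p).map some) []) d e w k o rfl
    simp only [fam, Tape.write_self, moveHead_none, moveHead_some, tp_write, tp_move_right,
      phaseMark_phase, List.tail_cons, List.headI_cons] at h
    have h2 := ih (some b :: il) (p + 1) (s || b)
    rw [revRow_succ, phase_succ] at h2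
    have h3 := h.trans h2
    have e1 : p + 1 + l.length = p + (l.length + 1) := by ring
    have e2 : (s || b || decide (true ∈ l)) = (s || decide (true ∈ b :: l)) := by
      cases b <;> simp
    rw [e1, e2, Nat.add_comm 1] at h3
    simpa using h3

theorem run_read_end (i x d e w k o : Tape (Option Bool)) (hi : i.head = none)
    (p : ℕ) (s : Bool) :
    Run 1
      (conf (.read s (phase p)) i x (tp ((revRow 0 p).map some) []) d e w k o)
      (conf (.back 0) i x (endTape (revRow 0 (p + if s = true then 1 else 0))) d e w k o) := by
  have h := step_conf (.read s (phase p)) i x (tp ((revRow 0 p).map some) []) d e w k o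
    (by simp only [delta, fam, hi]; rfl)
  simp only [← hi, Tape.write_self, moveHead_none] at h
  cases s with
  | true =>
    simp only [if_true, moveHead_none, tp_write, phaseMark_phase] at h ⊢
    rw [revRow_succ]
    exact h
  | false =>
    simp only [Bool.false_eq_true, if_false, moveHead_some, Tape.write_self, tp_move_left,
      headI_map_some, add_zero, endTape, List.map_tail] at h ⊢
    exact h

theorem init_eq (l : List Bool) : machine.init l
    = conf .init (tp [] (l.map some)) (tp [] []) (tp [] []) (tp [] []) (tp [] []) (tp [] [])
      (tp [] []) (tp [] []) := by
  simp only [MultitapeTM.init, conf]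
  congr 1
  funext t
  cases t <;> rfl

theorem run_start (m : ℕ) : ∃ i, Run ((binRep m).length + 1) (machine.init (binRep m))
    (conf (.back 0) i (tp [] []) (endTape (revRow 0 (Nat.clog 2 m))) (ctr 0) (ctr 0) (ctr 0)
      (tp [] []) (tp [] [])) := by
  obtain ⟨b, l, hl, hm⟩ := binRep_clog m
  have h := step_conf .init (tp [] (some b :: l.map some)) (tp [] []) (tp [] []) (tp [] [])
    (tp [] []) (tp [] []) (tp [] []) (tp [] []) rfl
  simp only [fam, Tape.write_self, moveHead_none, moveHead_some, tp_write, tp_move_right,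
    List.tail_cons, List.headI_cons, List.tail_nil] at h
  have h2 := run_read (tp [] []) (ctr 0) (ctr 0) (ctr 0) (tp [] []) (tp [] []) l [some b] 0 false
  have h3 := run_read_end (tp (l.reverse.map some ++ [some b]) []) (tp [] []) (ctr 0) (ctr 0)
    (ctr 0) (tp [] []) (tp [] []) rfl (0 + l.length) (false || decide (true ∈ l))
  refine ⟨tp (l.reverse.map some ++ [some b]) [], ?_⟩
  have h4 := (h.trans h2).trans h3
  simp only [Bool.false_or, decide_eq_true_eq, Nat.zero_add, ← hm] at h4
  rw [init_eq, hl, List.length_cons, Nat.add_comm l.length]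
  exact h4

/-! ### A pass over a row -/

theorem ctr_succ_write_none (n : ℕ) : (ctr (n + 1)).write none = ctr (n + 1) := by
  conv_rhs => rw [← Tape.write_self (ctr (n + 1)), ctr_succ_head]

theorem run_pass_step (n role : Bool) {k p a b : ℕ} (h : PassInv k p a b)
    (i K o : Tape (Option Bool)) (xs ys : List (Option Bool)) (w : ℕ) :
    ∃ role' a' b', PassInv k (p + 1) a' b' ∧
    Run 1
      (conf (.pass n role) i (tp [] (some (mark k p) :: xs)) (tp ys [])
        (ctr (if role then b else a)) (ctr (if role then a else b)) (ctr w) K o)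
      (conf (.pass n role') i (tp [] xs) (tp (some (mark (k + 1) p) :: ys) [])
        (ctr (if role' then b' else a')) (ctr (if role' then a' else b'))
        (ctr (w + if n = true ∧ mark (k + 1) p = false then 1 else 0)) (K.move Dir.right) o) := by
  rcases hb : mark k p with _ | _
  · refine ⟨role, a, b + 1, h.of_not_mark hb, ?_⟩
    rw [h.mark_succ_of_not_mark hb]
    have h := step_conf (.pass n role) i (tp [] (some false :: xs)) (tp ys [])
        (ctr (if role then b else a)) (ctr (if role then a else b)) (ctr w) K o rfl
    simp only [fam, Tape.write_self] at h
    cases n <;> cases role <;>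
    simpa [moveHead_none, moveHead_some, tp_write, tp_move_right, shift_move_right,
      shift_move_left, tp_none_left] using h
  · cases a with
    | zero =>
      refine ⟨!role, b, 0, h.of_mark_of_zero hb, ?_⟩
      rw [h.mark_succ_of_zero hb]
      cases role
      · have h := step_conf (.pass n false) i (tp [] (some true :: xs)) (tp ys [])
          (ctr 0) (ctr b) (ctr w) K o rfl
        simp only [fam, Tape.write_self] at h
        simpa [moveHead_none, moveHead_some, tp_write, tp_move_right, shift_move_right,
          shift_move_left, tp_none_left] using h
      · have h := step_conf (.pass n true) i (tp [] (some true :: xs)) (tp ys [])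
          (ctr b) (ctr 0) (ctr w) K o rfl
        simp only [fam, Tape.write_self] at h
        simpa [moveHead_none, moveHead_some, tp_write, tp_move_right, shift_move_right,
          shift_move_left, tp_none_left] using h
    | succ a =>
      refine ⟨role, a, b + 1, h.of_mark_of_pos hb, ?_⟩
      rw [h.mark_succ_of_pos]
      cases role
      · have h := step_conf (.pass n false) i (tp [] (some true :: xs)) (tp ys [])
          (ctr (a + 1)) (ctr b) (ctr w) K o
          (by simp only [delta, fam, tp_head, List.headI_cons, ctr_succ_head, if_true,
                Bool.false_eq_true, if_false]; rfl)
        simp only [Tape.write_self, ctr_succ_write_none] at h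
        cases n <;>
        simpa [moveHead_none, moveHead_some, tp_write, tp_move_right, shift_move_right,
          shift_move_left, tp_none_left] using h
      · have h := step_conf (.pass n true) i (tp [] (some true :: xs)) (tp ys [])
          (ctr b) (ctr (a + 1)) (ctr w) K o
          (by simp only [delta, fam, tp_head, List.headI_cons, ctr_succ_head, if_true]; rfl)
        simp only [Tape.write_self, ctr_succ_write_none] at h
        cases n <;>
        simpa [moveHead_none, moveHead_some, tp_write, tp_move_right, shift_move_right,
          shift_move_left, tp_none_left] using h

/-- The letters of the row `k` at the `n` positions from `p` on. -/
noncomputable def rowFrom (k p n : ℕ) : List Bool := (List.range' p n).map (mark k)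

theorem rowFrom_succ (k p n : ℕ) : rowFrom k p (n + 1) = mark k p :: rowFrom k (p + 1) n := by
  simp [rowFrom, List.range'_succ]

theorem reverse_revRow (k p : ℕ) : (revRow k p).reverse = rowFrom k 0 p := by
  rw [revRow, rowFrom, ← List.map_reverse, List.reverse_reverse, List.range_eq_range']

theorem run_pass_prefix (n : Bool) (k c p : ℕ) (hp : p + 1 ≤ c) (i K o : Tape (Option Bool)) :
    ∃ role a b, PassInv k (p + 1) a b ∧
    Run (p + 1)
      (conf (.row n) i (tp [] ((rowFrom k 0 c).map some)) (tp [] []) (ctr 0) (ctr 0) (ctr 0) K o)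
      (conf (.pass n role) i (tp [] ((rowFrom k (p + 1) (c - (p + 1))).map some))
        (tp ((revRow (k + 1) (p + 1)).map some) []) (ctr (if role then b else a))
        (ctr (if role then a else b)) (ctr (if n then p - cnt (k + 1) (p + 1) else 0))
        (shift (p + 1) K) o) := by
  induction p with
  | zero =>
    refine ⟨false, 0, 0, passInv_one k, ?_⟩
    obtain ⟨c, rfl⟩ : ∃ c', c = c' + 1 := ⟨c - 1, by omega⟩
    rw [rowFrom_succ, revRow_succ, mark_zero (k + 1)]
    have h := step_conf (.row n) i (tp [] (some (mark k 0) :: (rowFrom k 1 c).map some)) (tp [] [])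
      (ctr 0) (ctr 0) (ctr 0) K o rfl
    simp only [fam, Tape.write_self, moveHead_none, moveHead_some, tp_write, tp_move_right,
      List.tail_cons, List.headI_cons, tp_none_left] at h
    simpa [revRow, shift] using h
  | succ p ih =>
    obtain ⟨role, a, b, hI, hR⟩ := ih (by omega)
    obtain ⟨c', hc⟩ : ∃ c', c - (p + 1) = c' + 1 := ⟨c - (p + 1) - 1, by omega⟩
    have hc' : c - (p + 1 + 1) = c' := by omega
    rw [hc, rowFrom_succ] at hR
    obtain ⟨role', a', b', hI', hS⟩ := run_pass_step n role hI i (shift (p + 1) K) o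
      ((rowFrom k (p + 1 + 1) c').map some) ((revRow (k + 1) (p + 1)).map some)
      (if n then p - cnt (k + 1) (p + 1) else 0)
    refine ⟨role', a', b', hI', ?_⟩
    have hw : ((if n = true then p - cnt (k + 1) (p + 1) else 0) +
        if n = true ∧ mark (k + 1) (p + 1) = false then 1 else 0)
        = if n = true then p + 1 - cnt (k + 1) (p + 1 + 1) else 0 := by
      have := cnt_lt (k + 1) (p + 1) (by omega)
      rw [cnt_succ (k + 1) (p + 1)]
      cases n <;> cases mark (k + 1) (p + 1) <;> simp <;> omega
    rw [hw, shift_move_right] at hS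
    rw [hc', revRow_succ _ (p + 1)]
    exact hR.trans hS

theorem run_pass (n : Bool) (k c : ℕ) (hc : 1 ≤ c) (i K o : Tape (Option Bool)) :
    ∃ role a b, a ≤ c ∧ b ≤ c ∧
    Run c
      (conf (.row n) i (tp [] ((rowFrom k 0 c).map some)) (tp [] []) (ctr 0) (ctr 0) (ctr 0) K o)
      (conf (.pass n role) i (tp [] []) (tp ((revRow (k + 1) c).map some) []) (ctr a) (ctr b)
        (ctr (if n then c - 1 - cnt (k + 1) c else 0)) (shift c K) o) := by
  obtain ⟨p, rfl⟩ : ∃ c', c = c' + 1 := ⟨c - 1, by omega⟩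
  obtain ⟨role, a, b, hI, hR⟩ := run_pass_prefix n k (p + 1) p le_rfl i K o
  have := hI.sum
  refine ⟨role, if role then b else a, if role then a else b, ?_, ?_, ?_⟩
  · split_ifs <;> omega
  · split_ifs <;> omega
  · simpa [rowFrom] using hR

theorem run_turn (n role : Bool) (c : ℕ) (hc : 1 ≤ c) (l : List Bool)
    (i d e w K o : Tape (Option Bool)) (hK : (shift c K).head = none) :
    Run 1
      (conf (.pass n role) i (tp [] []) (tp (l.map some) []) d e w (shift c K) o)
      (conf (.back (if n then 2 else 1)) i (tp [] []) (endTape l) d e w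
        (shift c (K.move Dir.left)) o) := by
  have h := step_conf (.pass n role) i (tp [] []) (tp (l.map some) []) d e w (shift c K) o
    (ax := (none, none)) (ay := (none, some Dir.left))
    (by simp only [delta, fam, tp_head, List.headI_nil, hK]; rfl)
  obtain ⟨c, rfl⟩ : ∃ c', c = c' + 1 := ⟨c - 1, by omega⟩
  have hs : shift (c + 1) (K.move Dir.left) = shift c K := by
    rw [shift, Function.iterate_succ_apply, Tape.move_left_right]
  rw [hs, endTape, List.map_tail]
  simp only [← hK, Tape.write_self, moveHead_none, moveHead_some, shift_move_left] at h
  simp only [hK, tp_write, tp_move_left, headI_map_some, List.tail_nil, tp_none_right] at h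
  exact h

theorem run_pass_back (n : Bool) (k c : ℕ) (hc : 1 ≤ c) (i K o : Tape (Option Bool))
    (hK : (shift c K).head = none) :
    Run (2 * c + 1)
      (conf (.row n) i (tp [] ((rowFrom k 0 c).map some)) (tp [] []) (ctr 0) (ctr 0) (ctr 0) K o)
      (conf (.back (if n then 2 else 1)) i
        (tp [] (none :: (rowFrom (k + 1) 0 (if n then cnt (k + 1) c + 1 else c)).map some))
        (tp [] []) (ctr 0) (ctr 0) (ctr 0) (K.move Dir.left) o) := by
  obtain ⟨role, a, b, ha, hb, h1⟩ := run_pass n k c hc i K o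
  have h2 := run_turn n role c hc (revRow (k + 1) c) i (ctr a) (ctr b)
    (ctr (if n then c - 1 - cnt (k + 1) c else 0)) K o hK
  have hlen := length_revRow (k + 1) c
  have hcnt := cnt_lt (k + 1) c hc
  have h3 := run_back (if n then 2 else 1) i (K.move Dir.left) o (revRow (k + 1) c) [] a b
    (if n then c - 1 - cnt (k + 1) c else 0) (by omega) (by omega) (by split_ifs <;> omega)
  have e1 : c - (if n = true then c - 1 - cnt (k + 1) c else 0)
      = if n = true then cnt (k + 1) c + 1 else c := by split_ifs <;> omega
  rw [hlen, drop_revRow, reverse_revRow, List.append_nil, List.map_nil, tp_none_right, e1] at h3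
  have h4 := (h1.trans h2).trans h3
  have e2 : c + 1 + c = 2 * c + 1 := by ring
  rwa [e2] at h4

theorem shift_blank (n : ℕ) : shift n (tp [] []) = tp [] [] := by
  refine Function.iterate_fixed ?_ n
  rw [tp_move_right]
  exact tp_none_left _

/-- The configuration before the pass that computes the row `k + 1` of the Ackermann function on
the positions below `c` from the row `k`. -/
noncomputable abbrev rowConf (i : Tape (Option Bool)) (k c : ℕ) :
    MultitapeTM.Cfg Tp St (Option Bool) :=
  conf (.row true) i (tp [] ((rowFrom (k + 1) 0 c).map some)) (tp [] []) (ctr 0) (ctr 0) (ctr 0)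
    (tp [] (List.replicate (k + 1) (some true))) (endTape (binRep k).reverse)

theorem getI_replicate (n c : ℕ) :
    (List.replicate n (some true)).getI c = if c < n then some true else none := by
  split_ifs with h
  · rw [List.getI_eq_getElem _ (by simpa using h), List.getElem_replicate]
  · rw [List.getI_eq_default _ (by simpa using h)]; rfl

theorem run_row_next (i : Tape (Option Bool)) (k c : ℕ) (hk : k < c) :
    ∃ n ≤ 9 * c, Run n (rowConf i k c) (rowConf i (k + 1) (cnt (k + 2) c + 1)) := by
  have h1 := run_pass_back true (k + 1) c (by omega) i
    (tp [] (List.replicate (k + 1) (some true))) (endTape (binRep k).reverse)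
    (by rw [shift_head, getI_replicate, if_neg (by omega)])
  simp only [if_true] at h1
  have h2 := step_conf (.back 2) i
    (tp [] (none :: (rowFrom (k + 1 + 1) 0 (cnt (k + 1 + 1) c + 1)).map some)) (tp [] []) (ctr 0)
    (ctr 0) (ctr 0) ((tp [] (List.replicate (k + 1) (some true))).move Dir.left)
    (endTape (binRep k).reverse) (q' := .inc) (ak := (some true, none)) rfl
  simp only [fam, Tape.write_self, moveHead_none, moveHead_some, tp_move_right, tp_move_left,
    tp_write, List.tail_cons, List.headI_cons, tp_none_left, List.tail_nil] at h2
  obtain ⟨n, hn, h3⟩ := run_incr i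
    (tp [] ((rowFrom (k + 1 + 1) 0 (cnt (k + 1 + 1) c + 1)).map some)) (tp [] []) (ctr 0) (ctr 0)
    (ctr 0) (tp [] (List.replicate (k + 1 + 1) (some true))) (binRep k).reverse
  rw [← binRep_reverse_succ] at h3
  have hl := length_binRep_le k
  rw [List.length_reverse] at hn
  exact ⟨2 * c + 1 + 1 + n, by omega, (h1.trans h2).trans h3⟩

/-- The machine halts within `n` steps from `c`, with the word `v` on its output tape. -/
def HaltsWith (n : ℕ) (c : MultitapeTM.Cfg Tp St (Option Bool)) (v : List Bool) : Prop :=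
  ∃ t ≤ n, ∃ c', Run t c c' ∧ machine.step c' = none ∧ c'.tape .out = tp [] (v.map some)

theorem HaltsWith.of_run {m n r : ℕ} {c c' : MultitapeTM.Cfg Tp St (Option Bool)} {v : List Bool}
    (h : Run m c c') (h' : HaltsWith n c' v) (hr : m + n ≤ r) : HaltsWith r c v := by
  obtain ⟨t, ht, c'', h1, h2⟩ := h'
  exact ⟨m + t, by omega, c'', h.trans h1, h2⟩

theorem haltsWith_halt (i x y d e w k : Tape (Option Bool)) (v : List Bool) :
    HaltsWith 0 (conf .halt i x y d e w k (tp [] (v.map some))) v :=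
  ⟨0, le_rfl, _, Run.refl _, rfl, rfl⟩

theorem haltsWith_row_stop (i : Tape (Option Bool)) (k c : ℕ) (hc : 1 ≤ c) (hk : c ≤ k) :
    HaltsWith (c + k + 3) (rowConf i k c) (binRep k) := by
  obtain ⟨role, a, b, -, -, h1⟩ := run_pass true (k + 1) c hc i
    (tp [] (List.replicate (k + 1) (some true))) (endTape (binRep k).reverse)
  have hK : (shift c (tp [] (List.replicate (k + 1) (some true)))).head = some true := by
    rw [shift_head, getI_replicate, if_pos (by omega)]
  have h2 := step_conf (.pass true role) i (tp [] [])
    (tp ((revRow (k + 1 + 1) c).map some) []) (ctr a) (ctr b)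
    (ctr (if true then c - 1 - cnt (k + 1 + 1) c else 0))
    (shift c (tp [] (List.replicate (k + 1) (some true)))) (endTape (binRep k).reverse)
    (q' := .fin) (ax := ((tp [] []).head, none))
    (ay := ((tp ((revRow (k + 1 + 1) c).map some) []).head, none))
    (ak := ((shift c (tp [] (List.replicate (k + 1) (some true)))).head, none))
    (by simp only [delta, fam, tp_head, List.headI_nil, hK]; rfl)
  simp only [Tape.write_self, moveHead_none] at h2
  have h3 := run_fin i (tp [] []) (tp ((revRow (k + 1 + 1) c).map some) []) (ctr a) (ctr b)
    (ctr (if true then c - 1 - cnt (k + 1 + 1) c else 0))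
    (shift c (tp [] (List.replicate (k + 1) (some true)))) (binRep k).reverse []
  rw [List.append_nil, List.reverse_reverse] at h3
  have hl := length_binRep_le k
  rw [List.length_reverse] at h3
  exact HaltsWith.of_run ((h1.trans h2).trans h3) (haltsWith_halt _ _ _ _ _ _ _ _) (by omega)

theorem haltsWith_rowConf {m : ℕ} (hm : 1 < m) (i : Tape (Option Bool)) (k : ℕ)
    (hk : ∀ j < k, ¬ m ≤ Ack j) :
    HaltsWith (18 * level m k + 28 * (level m k - k) + k + 3) (rowConf i k (level m k))
      (binRep (alpha m)) := by
  induction hs : level m k - k using Nat.strong_induction_on generalizing k with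
  | _ s ih =>
    subst hs
    rcases Nat.lt_or_ge k (level m k) with h | h
    · obtain ⟨n, hn, hR⟩ := run_row_next i k (level m k) h
      have hle := cnt_lt (k + 2) (level m k) (by omega)
      have hhalf : 2 * cnt (k + 2) (level m k) ≤ level m k + 1 := two_mul_cnt_le (k + 1) _
      have hnext : level m (k + 1) = cnt (k + 2) (level m k) + 1 := rfl
      rw [← hnext] at hR
      refine HaltsWith.of_run hR (ih (level m (k + 1) - (k + 1)) (by omega) (k + 1) ?_ rfl)
        (by simp only [hnext] at *; omega)
      intro j hj
      rcases Nat.lt_succ_iff_lt_or_eq.1 hj with hj | rfl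
      · exact hk j hj
      · rw [Ack, ← level_le_iff hm]
        omega
    · have hpos : 1 ≤ level m k := by
        by_contra! h0
        have h1 := (level_le_iff hm k 0).1 (by omega)
        rw [A_zero_right] at h1
        omega
      rw [alpha_eq_of ((level_le_iff hm k k).1 h) hk]
      obtain ⟨t, ht, h⟩ := haltsWith_row_stop i k (level m k) hpos h
      exact ⟨t, by omega, h⟩

theorem haltsWith_machine (m : ℕ) :
    HaltsWith (60 * (binRep m).length) (machine.init (binRep m)) (binRep (alpha m)) := by
  obtain ⟨i, h1⟩ := run_start m
  obtain ⟨b, l, hl, hclog⟩ := binRep_clog m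
  have hlen : Nat.clog 2 m + 1 ≤ (binRep m).length + 1 := by
    rw [hl, hclog, List.length_cons]
    split_ifs <;> omega
  have hpos : 1 ≤ (binRep m).length := by rw [hl]; simp
  have h2 := run_back 0 i (tp [] []) (tp [] []) (revRow 0 (Nat.clog 2 m)) [] 0 0 0 (by omega)
    (by omega) (by omega)
  rw [shift_blank, List.map_nil, tp_none_right, List.append_nil, List.drop_zero, reverse_revRow,
    length_revRow] at h2
  have h3 := step_conf (.back 0) i (tp [] (none :: (rowFrom 0 0 (Nat.clog 2 m)).map some))
    (tp [] []) (ctr 0) (ctr 0) (ctr 0) (tp [] []) (tp [] []) (q' := .row false)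
    (ak := (none, none)) (ao := (none, none)) rfl
  simp only [fam, Tape.write_self, moveHead_none, moveHead_some, tp_move_right,
    tp_write, List.tail_cons, List.headI_cons, tp_none_left, List.tail_nil, tp_none_right] at h3
  have h4 := (h1.trans h2).trans h3
  rcases Nat.lt_or_ge 1 m with hm | hm
  · have hc : 1 ≤ Nat.clog 2 m := Nat.clog_pos (by norm_num) hm
    have h5 := run_pass_back false 0 (Nat.clog 2 m) hc i (tp [] []) (tp [] [])
      (by rw [shift_blank]; rfl)
    simp only [Bool.false_eq_true, if_false] at h5
    have h6 := step_conf (.back 1) i (tp [] (none :: (rowFrom (0 + 1) 0 (Nat.clog 2 m)).map some))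
      (tp [] []) (ctr 0) (ctr 0) (ctr 0) ((tp [] []).move Dir.left) (tp [] [])
      (q' := .row true) (ak := (some true, none)) (ao := (some false, none)) rfl
    simp only [fam, Tape.write_self, moveHead_none, moveHead_some, tp_move_right, tp_move_left,
      tp_write, List.tail_cons, List.headI_cons, tp_none_left, List.tail_nil] at h6
    rw [tp_move_left] at h5
    have h7 := haltsWith_rowConf hm i 0 (by omega)
    rw [level] at h7
    exact HaltsWith.of_run ((h4.trans h5).trans h6) h7 (by omega)
  · have hc : Nat.clog 2 m = 0 := Nat.clog_of_right_le_one hm 2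
    have ha : alpha m = 0 := alpha_eq_of (by rw [Ack, A_zero_right]; exact hm) (by omega)
    rw [hc] at h4
    have h5 := step_conf (.row false) i (tp [] []) (tp [] []) (ctr 0) (ctr 0) (ctr 0) (tp [] [])
      (tp [] []) rfl
    rw [ha]
    exact HaltsWith.of_run (h4.trans h5) (haltsWith_halt _ _ _ _ _ _ _ (binRep 0)) (by omega)

end InverseAckermann

theorem proposition5p5 :
    InverseAckermann.ComputableInLinearTime InverseAckermann.alpha := by
  refine ⟨60, InverseAckermann.Tp, InverseAckermann.St, Option Bool, inferInstance, inferInstance,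
    inferInstance, inferInstance, inferInstance, InverseAckermann.machine, fun m => ?_⟩
  obtain ⟨t, ht, c, h⟩ := InverseAckermann.haltsWith_machine m
  exact ⟨t, ht, c, h⟩
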